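/- Let $G=(V,E,w)$ be a finite simple weighted graph, possibly non-bipartite, with integer weights $w_e\in[W]=\{1,\dots,W\}$. Write $\mu_w(\cdot)$ for the maximum weight of a matching. The unfolded graph $\phi(G)$ is the unweighted graph whose vertices are the copies $u^1,\dots,u^{W_u}$ of each $u\in V$, where $W_u=\max_{e\ni u}w_e$ (and $W_u=0$ if $u$ is isolated), and whose edges are $(u^i,v^{w_e-i+1})$ for each edge $e=(u,v)\in E$ and each $1\le i\le w_e$. For a set (or subgraph) $F$ of edges of $\phi(G)$, the refolding $\mathcal R(F)$ is the subgraph of $G$ with vertex set $V$ consisting of all edges $e=(u,v)\in E$ such that $(u^i,v^{w_e-i+1})\in F$ for some $1\le i\le w_e$, with the weights of $G$. Let $\epsilon>0$, let $0<\lambda\le \epsilon/512$, and let $\beta$ be a real number with $\beta\ge \frac{144}{\lambda^2}\log(2W/\lambda)$, where $\log$ is the natural logarithm. Let $G_S\subseteq G$ be a subgraph (with the weights of $G$). Let $H\subseteq\phi(G)$ be a subgraph with bounded edge-degree $\beta$, that is, $\deg_H(x)+\deg_H(y)\le\beta$ for every edge $(x,y)\in H$. Let $U$ be the set of $(\phi(G_S),H,\beta,\lambda)$-underfull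 edges, that is, the set of all edges $(x,y)\in\phi(G_S)\setminus H$ with $\deg_H(x)+\deg_H(y)<\beta(1-\lambda)$. Then $$\mu_w\big(\mathcal R(H\cup U)\big)\;\ge\;\Big(\frac23-\epsilon\Big)\,\mu_w(G_S).$$ -/

import Mathlib

/-! Weighted graphs are pairs `(G, w)` of a simple graph `G` on a finite vertex type `V` and a weight
function `w : Sym2 V → ℕ`, of which only the values on edges of `G` matter. -/

namespace Refolding

/-- `μ_w(G)`: the maximum of `∑_{e ∈ M} w e` over all matchings `M` of `G`. -/
noncomputable def maxMatchingWeight {V : Type*} (G : SimpleGraph V) (w : Sym2 V → ℕ) : ℕ :=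
  sSup {x | ∃ M : G.Subgraph, M.IsMatching ∧ x = ∑ᶠ e ∈ M.edgeSet, w e}

/-- On a finite vertex set the supremum that defines `μ_w(G)` is a maximum. -/
theorem maxMatchingWeight_isGreatest {V : Type*} [Finite V] (G : SimpleGraph V)
    (w : Sym2 V → ℕ) :
    IsGreatest {x | ∃ M : G.Subgraph, M.IsMatching ∧ x = ∑ᶠ e ∈ M.edgeSet, w e}
      (maxMatchingWeight G w) := by
  have hne : {x | ∃ M : G.Subgraph, M.IsMatching ∧ x = ∑ᶠ e ∈ M.edgeSet, w e}.Nonempty :=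
    ⟨_, ⊥, fun _ hv => hv.elim, rfl⟩
  have hfin : {x | ∃ M : G.Subgraph, M.IsMatching ∧ x = ∑ᶠ e ∈ M.edgeSet, w e}.Finite := by
    refine (Set.finite_range (fun F : Set (Sym2 V) => ∑ᶠ e ∈ F, w e)).subset ?_
    rintro x ⟨M, -, rfl⟩
    exact ⟨M.edgeSet, rfl⟩
  exact ⟨Nat.sSup_mem hne hfin.bddAbove, fun x hx => le_csSup hfin.bddAbove hx⟩

/-- `W_u`: the maximum weight of an edge of `G` incident on `u` (`0` if there is none). -/
noncomputable def maxIncidentWeight {V : Type*} (G : SimpleGraph V) (w : Sym2 V → ℕ) (u : V) : ℕ :=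
  sSup (w '' G.incidenceSet u)

theorem weight_le_maxIncidentWeight {V : Type*} [Finite V] (G : SimpleGraph V) (w : Sym2 V → ℕ)
    {u v : V} (h : G.Adj u v) : w s(u, v) ≤ maxIncidentWeight G w u :=
  le_csSup (Set.toFinite _).bddAbove
    ⟨s(u, v), (SimpleGraph.mk'_mem_incidenceSet_left_iff G).2 h, rfl⟩

/-- The unfolded graph `φ(G)`. Its vertices are the copies `u^i = (u, i)` with `1 ≤ i ≤ W_u`; an edge
`e = uv` of `G` gives the `w e` edges `u^i v^j` with `i, j ≥ 1` and `i + j = w e + 1`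
(that is, `1 ≤ i ≤ w e` and `j = w e - i + 1`). -/
noncomputable def unfolding {V : Type*} [Finite V] (G : SimpleGraph V) (w : Sym2 V → ℕ) :
    (⊤ : SimpleGraph (V × ℕ)).Subgraph where
  verts := {p | 1 ≤ p.2 ∧ p.2 ≤ maxIncidentWeight G w p.1}
  Adj p q := G.Adj p.1 q.1 ∧ 1 ≤ p.2 ∧ 1 ≤ q.2 ∧ p.2 + q.2 = w s(p.1, q.1) + 1
  adj_sub := by
    rintro p q ⟨h, -⟩ rfl
    exact h.ne rfl
  edge_vert := by
    rintro p q ⟨h, h1, h2, h3⟩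
    have := weight_le_maxIncidentWeight G w h
    exact ⟨h1, by omega⟩
  symm := by
    refine ⟨fun p q h => ?_⟩
    obtain ⟨h, h1, h2, h3⟩ := h
    exact ⟨h.symm, h2, h1, by rw [add_comm, h3, Sym2.eq_swap]⟩

/-- The refolded graph `R(F)` of a set `F` of edges of `φ(G)`: it has vertex set `V`, and an edge
`e = uv` of `G` belongs to it iff `u^i v^j ∈ F` for some `i, j ≥ 1` with `i + j = w e + 1`. -/
def refolding {V : Type*} (G : SimpleGraph V) (w : Sym2 V → ℕ) (F : Set (Sym2 (V × ℕ))) :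
    SimpleGraph V where
  Adj u v := G.Adj u v ∧
    ∃ i j : ℕ, 1 ≤ i ∧ 1 ≤ j ∧ i + j = w s(u, v) + 1 ∧ s((u, i), (v, j)) ∈ F
  symm := by
    refine ⟨fun u v h => ?_⟩
    obtain ⟨h, i, j, hi, hj, hij, hF⟩ := h
    exact ⟨h.symm, j, i, hj, hi, by rw [add_comm, hij, Sym2.eq_swap], by rwa [Sym2.eq_swap]⟩
  loopless := ⟨fun _ h => h.1.ne rfl⟩

/-- `deg_H(p)`, for graphs `H` in which every vertex has finitely many neighbours. -/
noncomputable def deg {X : Type*} {K : SimpleGraph X} (H : K.Subgraph) (p : X) : ℕ :=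
  (H.neighborSet p).ncard

/-- `H` has bounded edge-degree `β`. -/
def BoundedEdgeDegree {X : Type*} {K : SimpleGraph X} (H : K.Subgraph) (β : ℝ) : Prop :=
  ∀ p q, H.Adj p q → (deg H p : ℝ) + (deg H q : ℝ) ≤ β

/-- The set of `(A, H, β, lam)`-underfull edges: the edges `pq` of `A \ H` with
`deg_H(p) + deg_H(q) < β (1 - lam)`. -/
def underfullEdges {X : Type*} {K : SimpleGraph X} (A H : K.Subgraph) (β lam : ℝ) :
    Set (Sym2 X) :=
  {e | e ∈ A.edgeSet \ H.edgeSet ∧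
    ∃ p q, e = s(p, q) ∧ (deg H p : ℝ) + (deg H q : ℝ) < β * (1 - lam)}

end Refolding

/-! Fix a maximum weight matching of `GS`, with partner involution `σ`, and 2-colour the vertices so
that partners differ. By a second-moment argument some such colouring roughly halves the `H`-degrees
of vertex copies, in an averaged sense (`exists_coloring_of_small_discrepancy`). The bichromatic
edges of the refolding form a bipartite graph, so Egerváry (`exists_weight_cover`) gives a weighted
vertex cover `c` of total at most the matching weight sought. Its copies `C` cover every bichromatic
unfolded edge of `H ∪ U`.

The unfolded matching has `2μ` endpoints, where `μ` is the matching weight of `GS`. Let `S` be the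
endpoints of its edges missed by `C`, so `2μ ≤ |S| + 2|C|`. A missed edge is neither in `H` nor
underfull, so its `H`-degree sum is at least `β(1 - lam)`. All bichromatic `H`-edges at `S` end in
`C`, and the edge-degree bound then forces `|S| ≲ |C|` (`card_cover_lower_bound`). Hence `2μ ≲
3|C|`. -/

namespace Refolding

/-! ### Edge counting in graphs of bounded edge-degree -/

/-- Counting edges between a set `S` of vertices and a set `C` containing all their neighbours in
a spanning subgraph `Nf` of a graph `N` of bounded edge-degree, where the degrees in `Nf` are about
half of those in `N`. -/
theorem card_cover_lower_bound {X : Type*} [DecidableEq X] (N Nf : X → Finset X)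
    (hsub : ∀ p, Nf p ⊆ N p) (hsymm : ∀ p q, q ∈ Nf p → p ∈ Nf q) (β lam : ℝ) (hβ : 0 ≤ β)
    (dev : X → ℝ) (hdev : ∀ p, |((Nf p).card : ℝ) - (N p).card / 2| ≤ dev p)
    (hdeg : ∀ p, ∀ q ∈ N p, ((N p).card : ℝ) + (N q).card ≤ β)
    (S C : Finset X) (hSC : ∀ p ∈ S, Nf p ⊆ C)
    (hS : β * (1 - lam) * S.card ≤ 2 * ∑ p ∈ S, ((N p).card : ℝ)) :
    β ^ 2 / 16 * ((1 - 2 * lam) * S.card - C.card) ≤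
      ∑ p ∈ S, ∑ q ∈ N p, (dev p + dev q) + β / 2 * ∑ p ∈ S, dev p := by
  have hdev0 : ∀ p, 0 ≤ dev p := fun p => (abs_nonneg _).trans (hdev p)
  set E : ℝ := ∑ p ∈ S, ((Nf p).card : ℝ) with hE
  have hE1 : (∑ p ∈ S, ((N p).card : ℝ)) / 2 - ∑ p ∈ S, dev p ≤ E := by
    rw [Finset.sum_div, ← Finset.sum_sub_distrib]
    refine Finset.sum_le_sum fun p _ => ?_
    have := (abs_le.1 (hdev p)).1
    linarith
  -- Tangent-line bound for the square at `β / 4`, the average bichromatic degree on `S` in the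
  -- extremal case.
  have hA : β / 2 * E - β ^ 2 / 16 * S.card ≤ ∑ p ∈ S, ((Nf p).card : ℝ) * (Nf p).card := by
    have : β / 2 * E - β ^ 2 / 16 * S.card =
        ∑ p ∈ S, (β / 2 * ((Nf p).card : ℝ) - β ^ 2 / 16) := by
      rw [Finset.sum_sub_distrib, ← Finset.mul_sum, Finset.sum_const, nsmul_eq_mul]
      ring
    rw [this]
    refine Finset.sum_le_sum fun p _ => ?_
    nlinarith [sq_nonneg (((Nf p).card : ℝ) - β / 4)]
  have hswap : ∀ g : X → ℝ, ∑ p ∈ S, ∑ q ∈ Nf p, g q =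
      ∑ q ∈ C, ((S.filter (· ∈ Nf q)).card : ℝ) * g q := by
    intro g
    rw [Finset.sum_comm' (t' := C) (s' := fun q => S.filter (· ∈ Nf q))]
    · refine Finset.sum_congr rfl fun q _ => ?_
      rw [Finset.sum_const, nsmul_eq_mul]
    · intro p q
      simp only [Finset.mem_filter]
      exact ⟨fun ⟨h1, h2⟩ => ⟨⟨h1, hsymm _ _ h2⟩, hSC p h1 h2⟩,
        fun ⟨⟨h1, h2⟩, _⟩ => ⟨h1, hsymm _ _ h2⟩⟩
  -- Grouped by endpoint in `C`, each `q` contributes its degree into `S` times its full bichromatic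
  -- degree, hence at least the square of the former; the same tangent line applies.
  have hB : β / 2 * E - β ^ 2 / 16 * C.card ≤ ∑ p ∈ S, ∑ q ∈ Nf p, ((Nf q).card : ℝ) := by
    have hE' : E = ∑ q ∈ C, ((S.filter (· ∈ Nf q)).card : ℝ) := by
      have := hswap fun _ => 1
      simpa [hE] using this
    have : β / 2 * E - β ^ 2 / 16 * C.card =
        ∑ q ∈ C, (β / 2 * ((S.filter (· ∈ Nf q)).card : ℝ) - β ^ 2 / 16) := by
      rw [Finset.sum_sub_distrib, ← Finset.mul_sum, Finset.sum_const, nsmul_eq_mul, hE']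
      ring
    rw [this, hswap]
    refine Finset.sum_le_sum fun q _ => ?_
    have h1 : ((S.filter (· ∈ Nf q)).card : ℝ) ≤ (Nf q).card := by
      exact_mod_cast Finset.card_le_card fun x hx => (Finset.mem_filter.1 hx).2
    nlinarith [sq_nonneg (((S.filter (· ∈ Nf q)).card : ℝ) - β / 4),
      mul_le_mul_of_nonneg_left h1 (Nat.cast_nonneg (S.filter (· ∈ Nf q)).card)]
  have hAB : ∑ p ∈ S, ((Nf p).card : ℝ) * (Nf p).card +
      ∑ p ∈ S, ∑ q ∈ Nf p, ((Nf q).card : ℝ) ≤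
      β / 2 * E + ∑ p ∈ S, ∑ q ∈ N p, (dev p + dev q) := by
    rw [hE, Finset.mul_sum, ← Finset.sum_add_distrib, ← Finset.sum_add_distrib]
    refine Finset.sum_le_sum fun p _ => ?_
    calc ((Nf p).card : ℝ) * (Nf p).card + ∑ q ∈ Nf p, ((Nf q).card : ℝ)
        = ∑ q ∈ Nf p, (((Nf p).card : ℝ) + (Nf q).card) := by
          rw [Finset.sum_add_distrib, Finset.sum_const, nsmul_eq_mul]
      _ ≤ ∑ q ∈ Nf p, (β / 2 + (dev p + dev q)) := by
          refine Finset.sum_le_sum fun q hq => ?_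
          have h1 := (abs_le.1 (hdev p)).2
          have h2 := (abs_le.1 (hdev q)).2
          have h3 := hdeg p q (hsub p hq)
          linarith
      _ = β / 2 * (Nf p).card + ∑ q ∈ Nf p, (dev p + dev q) := by
          rw [Finset.sum_add_distrib, Finset.sum_const, nsmul_eq_mul]
          ring
      _ ≤ _ := by
          gcongr
          · exact fun q _ _ => add_nonneg (hdev0 p) (hdev0 q)
          · exact hsub p
  nlinarith [mul_le_mul_of_nonneg_left hE1 hβ, mul_le_mul_of_nonneg_left hS hβ]

/-! ### Weighted bipartite duality -/

/-- Egerváry's theorem for a square matrix of natural numbers. -/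
theorem exists_perm_cover {n : Type*} [Fintype n] (a : n → n → ℕ) :
    ∃ (σ : n → n) (y z : n → ℕ), σ.Injective ∧ (∀ i j, a i j ≤ y i + z j) ∧
      ∑ i, y i + ∑ j, z j = ∑ i, a i (σ i) := by
  classical
  -- Minimise over integer covers: the shift below may make potentials negative.
  obtain ⟨m, ⟨y, z, hcov, hm⟩, hmin⟩ := Int.exists_least_of_bdd
    (P := fun m : ℤ => ∃ y z : n → ℤ, (∀ i j, (a i j : ℤ) ≤ y i + z j) ∧ ∑ i, y i + ∑ j, z j = m)
    ⟨0, by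
      rintro _ ⟨y, z, h, rfl⟩
      rw [← Finset.sum_add_distrib]
      exact Finset.sum_nonneg fun i _ => (Int.natCast_nonneg _).trans (h i i)⟩
    ⟨_, fun i => ∑ j, (a i j : ℤ), fun _ => 0, fun i j => by
      rw [add_zero]
      exact Finset.single_le_sum (f := fun j => (a i j : ℤ)) (fun _ _ => Int.natCast_nonneg _)
        (Finset.mem_univ j), rfl⟩
  obtain ⟨σ, hσ, htight⟩ := (Finset.all_card_le_biUnion_card_iff_exists_injective
    fun i => Finset.univ.filter fun j => y i + z j = a i j).1 (by
      intro A
      by_contra! hA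
      set T := A.biUnion fun i => Finset.univ.filter fun j => y i + z j = a i j with hT
      -- A set `A` violating Hall's condition in the graph of tight entries would allow a cheaper
      -- cover: lower `y` on `A` and raise `z` on its tight neighbours `T`, changing the total by
      -- `|T| - |A| < 0`.
      have := hmin _ ⟨fun i => y i - if i ∈ A then 1 else 0, fun j => z j + if j ∈ T then 1 else 0,
        fun i j => by
          have h := hcov i j
          by_cases hi : i ∈ A <;> by_cases hj : j ∈ T <;> simp only [hi, hj, if_true, if_false]
          · linarith
          · have : y i + z j ≠ a i j := fun h => hj (Finset.mem_biUnion.2 ⟨i, hi, by simpa using h⟩)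
            omega
          · linarith
          · linarith, rfl⟩
      rw [Finset.sum_sub_distrib, Finset.sum_add_distrib] at this
      simp only [Finset.sum_ite_mem, Finset.univ_inter, Finset.sum_const, nsmul_eq_mul,
        mul_one] at this
      omega)
  simp only [Finset.mem_filter, Finset.mem_univ, true_and] at htight
  have hbij : σ.Bijective := Finite.injective_iff_bijective.1 hσ
  have hsum : ∑ i, y i + ∑ j, z j = ∑ i, (a i (σ i) : ℤ) := by
    rw [← hbij.sum_comp z, ← Finset.sum_add_distrib]
    exact Finset.sum_congr rfl fun i _ => htight i
  rcases isEmpty_or_nonempty n with hn | hn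
  · exact ⟨σ, fun _ => 0, fun _ => 0, hσ, fun i => hn.elim i, by simp⟩
  -- Moving the constant `y i₀`, the minimum of `y`, from `y` to `z` keeps all sums and makes both
  -- nonnegative, since `0 ≤ a i₀ j ≤ y i₀ + z j`.
  obtain ⟨i₀, hi₀⟩ := Finite.exists_min y
  have hy : ∀ i, 0 ≤ y i - y i₀ := fun i => sub_nonneg.2 (hi₀ i)
  have hz : ∀ j, 0 ≤ z j + y i₀ := fun j => by have := hcov i₀ j; omega
  refine ⟨σ, fun i => (y i - y i₀).toNat, fun j => (z j + y i₀).toNat, hσ, fun i j => ?_, ?_⟩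
  · have := hcov i j
    have := hy i
    have := hz j
    change a i j ≤ (y i - y i₀).toNat + (z j + y i₀).toNat
    omega
  · zify
    simp only [Int.toNat_of_nonneg (hy _), Int.toNat_of_nonneg (hz _)]
    rw [← hsum, Finset.sum_sub_distrib, Finset.sum_add_distrib]
    ring

/-- Egerváry's theorem for the edges of a weighted graph that are bichromatic in a 2-colouring of
the vertices. -/
theorem exists_weight_cover {V : Type*} [Fintype V] (K : SimpleGraph V) (w : Sym2 V → ℕ)
    (f : V → Bool) :
    ∃ c : V → ℕ, ∑ v, c v ≤ maxMatchingWeight K w ∧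
      ∀ u v, K.Adj u v → f u ≠ f v → w s(u, v) ≤ c u + c v := by
  classical
  obtain ⟨σ, y, z, hσ, hcov, hsum⟩ := exists_perm_cover fun u v =>
    if K.Adj u v ∧ f u = true ∧ f v = false then w s(u, v) else 0
  refine ⟨fun v => if f v then y v else z v, ?_, fun u v huv hne => ?_⟩
  · let T : Finset V := Finset.univ.filter fun u => K.Adj u (σ u) ∧ f u = true ∧ f (σ u) = false
    let M : K.Subgraph :=
      { verts := {x | x ∈ T ∨ ∃ u ∈ T, σ u = x}
        Adj := fun a b => (a ∈ T ∧ σ a = b) ∨ (b ∈ T ∧ σ b = a)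
        adj_sub := by
          rintro a b (⟨h, rfl⟩ | ⟨h, rfl⟩)
          · exact (Finset.mem_filter.1 h).2.1
          · exact (Finset.mem_filter.1 h).2.1.symm
        edge_vert := by
          rintro a b (⟨h, rfl⟩ | ⟨h, rfl⟩)
          · exact Or.inl h
          · exact Or.inr ⟨b, h, rfl⟩
        symm := ⟨fun a b h => h.symm⟩ }
    have hcol : ∀ u ∈ T, f u = true ∧ f (σ u) = false := fun u hu => (Finset.mem_filter.1 hu).2.2
    have hM : M.IsMatching := by
      rintro v (hv | ⟨u, hu, rfl⟩)
      · refine ⟨σ v, Or.inl ⟨hv, rfl⟩, ?_⟩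
        rintro b (⟨_, rfl⟩ | ⟨hb, rfl⟩)
        · rfl
        · exact absurd ((hcol _ hv).1.symm.trans (hcol _ hb).2) (by simp)
      · refine ⟨u, Or.inr ⟨hu, rfl⟩, ?_⟩
        rintro b (⟨hb, rfl⟩ | ⟨hb, h⟩)
        · exact absurd ((hcol _ hb).1.symm.trans (hcol _ hu).2) (by simp)
        · exact hσ h
    have hedge : M.edgeSet = (fun u => s(u, σ u)) '' (T : Set V) := by
      ext e
      induction e with | _ a b =>
      rw [SimpleGraph.Subgraph.mem_edgeSet]
      constructor
      · rintro (⟨h, rfl⟩ | ⟨h, rfl⟩)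
        · exact ⟨a, h, rfl⟩
        · exact ⟨b, h, Sym2.eq_swap⟩
      · rintro ⟨u, hu, h⟩
        rcases Sym2.eq_iff.1 h with ⟨rfl, rfl⟩ | ⟨rfl, rfl⟩
        · exact Or.inl ⟨hu, rfl⟩
        · exact Or.inr ⟨hu, rfl⟩
    have hinj : Set.InjOn (fun u => s(u, σ u)) (T : Set V) := by
      intro a ha b hb h
      rcases Sym2.eq_iff.1 h with ⟨h, _⟩ | ⟨h, _⟩
      · exact h
      · have := (hcol _ hb).2
        rw [← h, (hcol _ ha).1] at this
        simp at this
    have hle := (maxMatchingWeight_isGreatest K w).2 ⟨M, hM, rfl⟩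
    rw [hedge, finsum_mem_image hinj, finsum_mem_coe_finset] at hle
    refine le_trans ?_ hle
    rw [Finset.sum_filter, ← hsum, ← Finset.sum_add_distrib]
    refine Finset.sum_le_sum fun v _ => ?_
    split_ifs <;> omega
  · rcases hu : f u with _ | _ <;> rcases hv : f v with _ | _ <;> simp [hu, hv] at hne ⊢
    · have := hcov v u
      rw [if_pos ⟨huv.symm, hv, hu⟩, Sym2.eq_swap] at this
      omega
    · have := hcov u v
      rwa [if_pos ⟨huv, hu, hv⟩] at this

/-! ### Colourings that split the matching, and their discrepancy -/

/-- The sign of a colour. -/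
def colorSign (b : Bool) : ℝ := if b then 1 else -1

theorem colorSign_not (b : Bool) : colorSign (!b) = -colorSign b := by
  cases b <;> simp [colorSign]

theorem colorSign_mul_self (b : Bool) : colorSign b * colorSign b = 1 := by
  cases b <;> simp [colorSign]

theorem colorSign_mul_of_ne {a b : Bool} (h : a ≠ b) : colorSign a * colorSign b = -1 := by
  cases a <;> cases b <;> simp [colorSign] at h ⊢

/-- The 2-colourings in which `v` and `σ v` have different colours unless they are equal. -/
noncomputable def splitColorings {V : Type*} [Fintype V] (σ : V → V) : Finset (V → Bool) := by
  classical exact Finset.univ.filter fun s => ∀ v, σ v ≠ v → s v ≠ s (σ v)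

theorem mem_splitColorings {V : Type*} [Fintype V] {σ : V → V} {s : V → Bool} :
    s ∈ splitColorings σ ↔ ∀ v, σ v ≠ v → s v ≠ s (σ v) := by
  simp [splitColorings]

theorem splitColorings_nonempty {V : Type*} [Fintype V] {σ : V → V} (hσ : σ.Involutive) :
    (splitColorings σ).Nonempty := by
  let e := Fintype.equivFin V
  refine ⟨fun v => decide (e v < e (σ v)), mem_splitColorings.2 fun v hv h => ?_⟩
  have h1 : e (σ v) ≠ e v := fun h => hv (e.injective h)
  rw [decide_eq_decide, hσ v] at h
  omega

/-- Partners always have opposite signs. For any other pair, flipping the colours of `u` and `σ u`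
together is an involution of the split colourings that negates the product, so the sum vanishes. -/
theorem sum_colorSign_mul_nonpos {V : Type*} [Fintype V] {σ : V → V} (hσ : σ.Involutive)
    {u v : V} (huv : u ≠ v) :
    ∑ s ∈ splitColorings σ, colorSign (s u) * colorSign (s v) ≤ 0 := by
  classical
  by_cases h : v = σ u
  · subst h
    refine Finset.sum_nonpos fun s hs => ?_
    rw [colorSign_mul_of_ne (mem_splitColorings.1 hs u huv.symm)]
    norm_num
  · let flip : (V → Bool) → V → Bool := fun s x => if x = u ∨ x = σ u then !s x else s x
    have hinv : ∀ s, flip (flip s) = s := by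
      intro s
      funext x
      by_cases hx : x = u ∨ x = σ u <;> simp [flip, hx]
    have hmem : ∀ s ∈ splitColorings σ, flip s ∈ splitColorings σ := by
      intro s hs
      refine mem_splitColorings.2 fun x hx => ?_
      have h1 := mem_splitColorings.1 hs x hx
      have h2 : (σ x = u ∨ σ x = σ u) ↔ (x = u ∨ x = σ u) := by
        rw [hσ.injective.eq_iff, hσ.eq_iff, or_comm]
      by_cases hx : x = u ∨ x = σ u
      · simpa only [flip, h2, hx, if_true, ne_eq, Bool.not_inj_iff] using h1
      · simpa only [flip, h2, hx, if_false] using h1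
    have hneg : ∀ s, colorSign (flip s u) * colorSign (flip s v) =
        -(colorSign (s u) * colorSign (s v)) := by
      intro s
      have h1 : flip s u = !s u := by simp [flip]
      have h2 : flip s v = s v := if_neg (by simp [h, huv.symm])
      rw [h1, h2, colorSign_not, neg_mul]
    have hsum : ∑ s ∈ splitColorings σ, colorSign (s u) * colorSign (s v) =
        ∑ s ∈ splitColorings σ, -(colorSign (s u) * colorSign (s v)) :=
      Finset.sum_nbij' flip flip hmem hmem (fun s _ => hinv s) (fun s _ => hinv s)
        fun s _ => by rw [hneg, neg_neg]
    rw [Finset.sum_neg_distrib] at hsum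
    linarith

theorem sum_sq_sum_colorSign_le {V : Type*} [Fintype V] {σ : V → V} (hσ : σ.Involutive)
    (T : Finset V) :
    ∑ s ∈ splitColorings σ, (∑ v ∈ T, colorSign (s v)) ^ 2 ≤ T.card * (splitColorings σ).card := by
  classical
  calc ∑ s ∈ splitColorings σ, (∑ v ∈ T, colorSign (s v)) ^ 2
      = ∑ u ∈ T, ∑ v ∈ T, ∑ s ∈ splitColorings σ, colorSign (s u) * colorSign (s v) := by
        simp_rw [sq, Finset.sum_mul_sum]
        rw [Finset.sum_comm]
        exact Finset.sum_congr rfl fun u _ => Finset.sum_comm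
    _ ≤ ∑ u ∈ T, ∑ v ∈ T, if u = v then ((splitColorings σ).card : ℝ) else 0 := by
        refine Finset.sum_le_sum fun u _ => Finset.sum_le_sum fun v _ => ?_
        split_ifs with h
        · subst h
          simp [colorSign_mul_self]
        · exact sum_colorSign_mul_nonpos hσ h
    _ = _ := by
        rw [← nsmul_eq_mul, ← Finset.sum_const]
        exact Finset.sum_congr rfl fun u hu => by rw [Finset.sum_ite_eq, if_pos hu]

/-- Half the discrepancy of a colouring on a set of vertex copies. -/
noncomputable def discrepancy {V : Type*} (s : V → Bool) (T : Finset (V × ℕ)) : ℝ :=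
  |∑ q ∈ T, colorSign (s q.1)| / 2

theorem discrepancy_nonneg {V : Type*} (s : V → Bool) (T : Finset (V × ℕ)) :
    0 ≤ discrepancy s T := by
  unfold discrepancy
  positivity

theorem abs_card_bichromatic_sub_le {V : Type*} (s : V → Bool) (p : V × ℕ)
    (T : Finset (V × ℕ)) :
    |((T.filter fun q => s p.1 ≠ s q.1).card : ℝ) - T.card / 2| ≤ discrepancy s T := by
  have h : ((T.filter fun q => s p.1 ≠ s q.1).card : ℝ) - T.card / 2 =
      -(colorSign (s p.1) * ∑ q ∈ T, colorSign (s q.1)) / 2 := by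
    rw [Finset.card_filter, Finset.cast_card, Nat.cast_sum, Finset.sum_div,
      ← Finset.sum_sub_distrib, Finset.mul_sum, ← Finset.sum_neg_distrib, Finset.sum_div]
    refine Finset.sum_congr rfl fun q _ => ?_
    rcases s p.1 <;> rcases s q.1 <;> norm_num [colorSign]
  have h1 : |colorSign (s p.1)| = 1 := by rcases s p.1 <;> simp [colorSign]
  rw [h, abs_div, abs_neg, abs_mul, h1, one_mul, abs_two, discrepancy]

/-- Nonpositive correlations bound the mean square of the sign sum by `|T| ≤ β`. Injectivity of
`Prod.fst` on `T` is essential, as copies of one vertex share their colour. -/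
theorem sum_discrepancy_le {V : Type*} [Fintype V] {σ : V → V} (hσ : σ.Involutive)
    {β lam : ℝ} (hlam : 0 < lam) (hβ : 1 ≤ lam ^ 2 * β) (T : Finset (V × ℕ))
    (hT : Set.InjOn Prod.fst (T : Set (V × ℕ))) (hTβ : (T.card : ℝ) ≤ β) :
    ∑ s ∈ splitColorings σ, discrepancy s T ≤ lam * β * (splitColorings σ).card := by
  classical
  have hβ0 : 0 < β := by
    by_contra! h
    nlinarith [sq_nonneg lam]
  have h2 : ∑ s ∈ splitColorings σ, (∑ q ∈ T, colorSign (s q.1)) ^ 2 ≤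
      β * (splitColorings σ).card := by
    have := sum_sq_sum_colorSign_le hσ (T.image Prod.fst)
    simp_rw [Finset.sum_image hT] at this
    rw [Finset.card_image_of_injOn hT] at this
    exact this.trans (by gcongr)
  -- AM-GM at scale `lam * β` replaces Cauchy–Schwarz; `β ≤ (lam * β) ^ 2` then makes both terms
  -- affordable.
  have h1 : ∀ s ∈ splitColorings σ, lam * β * discrepancy s T ≤
      (∑ q ∈ T, colorSign (s q.1)) ^ 2 / 4 + (lam * β) ^ 2 / 4 := by
    intro s _
    rw [← sq_abs (∑ q ∈ T, colorSign (s q.1)), discrepancy]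
    nlinarith [sq_nonneg (|∑ q ∈ T, colorSign (s q.1)| - lam * β)]
  have h3 := Finset.sum_le_sum h1
  rw [← Finset.mul_sum, Finset.sum_add_distrib, ← Finset.sum_div, Finset.sum_const,
    nsmul_eq_mul] at h3
  have hpos : 0 < lam * β := mul_pos hlam hβ0
  refine le_of_mul_le_mul_left (h3.trans ?_) hpos
  have h4 : β ≤ (lam * β) ^ 2 := by nlinarith
  have h5 : (0 : ℝ) ≤ (splitColorings σ).card := Nat.cast_nonneg _
  nlinarith [mul_le_mul_of_nonneg_right h4 h5, mul_nonneg (sq_nonneg (lam * β)) h5]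

/-- Some split colouring has small total discrepancy on the neighbourhoods around `A`. -/
theorem exists_coloring_of_small_discrepancy {V : Type*} [Fintype V] {σ : V → V}
    (hσ : σ.Involutive) {β lam : ℝ} (hlam : 0 < lam) (hβ : 1 ≤ lam ^ 2 * β)
    (N : V × ℕ → Finset (V × ℕ)) (hN : ∀ p, Set.InjOn Prod.fst (N p : Set (V × ℕ)))
    (hNβ : ∀ p, ((N p).card : ℝ) ≤ β) (A : Finset (V × ℕ)) :
    ∃ s : V → Bool, (∀ v, σ v ≠ v → s v ≠ s (σ v)) ∧
      ∑ p ∈ A, ∑ q ∈ N p, (discrepancy s (N p) + discrepancy s (N q)) +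
        β / 2 * ∑ p ∈ A, discrepancy s (N p) ≤ 5 / 2 * lam * β ^ 2 * A.card := by
  have hβ0 : 0 ≤ β := by
    by_contra! h
    nlinarith [sq_nonneg lam]
  have hD := fun p => sum_discrepancy_le hσ hlam hβ (N p) (hN p) (hNβ p)
  set k : ℝ := ((splitColorings σ).card : ℝ) with hk
  have hpos : 0 ≤ lam * β * k := by positivity
  obtain ⟨s, hs, hle⟩ := Finset.exists_le_of_sum_le (splitColorings_nonempty hσ)
    (f := fun s => ∑ p ∈ A, ∑ q ∈ N p, (discrepancy s (N p) + discrepancy s (N q)) +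
        β / 2 * ∑ p ∈ A, discrepancy s (N p))
    (g := fun _ => 5 / 2 * lam * β ^ 2 * A.card) (by
      rw [Finset.sum_const, nsmul_eq_mul, Finset.sum_add_distrib, ← Finset.mul_sum,
        Finset.sum_comm, Finset.sum_comm (t := A)]
      -- Each `p` costs at most `β` neighbours times `2 * lam * β`, plus `β / 2` times `lam * β`:
      -- hence the factor `5 / 2`.
      calc _ ≤ ∑ p ∈ A, (β * (2 * (lam * β * k))) + β / 2 * ∑ p ∈ A, lam * β * k := by
            gcongr with p _ p _
            · rw [Finset.sum_comm]
              calc _ ≤ ∑ q ∈ N p, 2 * (lam * β * k) := by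
                    refine Finset.sum_le_sum fun q _ => ?_
                    rw [Finset.sum_add_distrib]
                    linarith [hD p, hD q]
                _ ≤ _ := by
                    rw [Finset.sum_const, nsmul_eq_mul]
                    exact mul_le_mul_of_nonneg_right (hNβ p) (by positivity)
            · exact hD p
        _ = _ := by
            rw [Finset.sum_const, Finset.sum_const, nsmul_eq_mul, nsmul_eq_mul]
            ring)
  exact ⟨s, mem_splitColorings.1 hs, hle⟩

/-! ### Vertex copies and the unfolded matching -/

/-- The vertex copies `u^i` with `1 ≤ i ≤ c u`. -/
def copies {V : Type*} [Fintype V] (c : V → ℕ) : Finset (V × ℕ) :=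
  (Finset.univ.sigma fun u => Finset.Icc 1 (c u)).map (Equiv.sigmaEquivProd V ℕ).toEmbedding

theorem mem_copies {V : Type*} [Fintype V] {c : V → ℕ} {p : V × ℕ} :
    p ∈ copies c ↔ 1 ≤ p.2 ∧ p.2 ≤ c p.1 := by
  simp [copies, Finset.mem_map_equiv]

theorem card_copies {V : Type*} [Fintype V] (c : V → ℕ) : (copies c).card = ∑ v, c v := by
  simp [copies]

theorem exists_matching_involution {V : Type*} {G : SimpleGraph V} {M : G.Subgraph}
    (hM : M.IsMatching) :
    ∃ σ : V → V, σ.Involutive ∧ ∀ u v, M.Adj u v ↔ σ u ≠ u ∧ σ u = v := by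
  classical
  choose m hm hm' using @hM
  let σ : V → V := fun v => if h : v ∈ M.verts then m h else v
  have h1 : ∀ u v, M.Adj u v ↔ σ u ≠ u ∧ σ u = v := by
    intro u v
    constructor
    · intro h
      have hu := M.edge_vert h
      have : σ u = v := by simp only [σ, dif_pos hu]; exact (hm' hu v h).symm
      exact ⟨this ▸ (M.adj_sub h).ne', this⟩
    · rintro ⟨h, rfl⟩
      by_cases hu : u ∈ M.verts
      · simp only [σ, dif_pos hu]
        exact hm hu
      · simp [σ, hu] at h
  refine ⟨σ, fun u => ?_, h1⟩
  by_cases h : σ u = u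
  · rw [h, h]
  · exact ((h1 _ _).1 ((h1 u _).2 ⟨h, rfl⟩).symm).2

theorem sum_matching_weight {V : Type*} [Fintype V] [DecidableEq V] {G : SimpleGraph V}
    {M : G.Subgraph} {σ : V → V} (hM : ∀ u v, M.Adj u v ↔ σ u ≠ u ∧ σ u = v)
    (w : Sym2 V → ℕ) :
    ∑ u, (if σ u ≠ u then w s(u, σ u) else 0) = 2 * ∑ᶠ e ∈ M.edgeSet, w e := by
  have hfin : M.edgeSet.Finite := Set.toFinite _
  rw [finsum_mem_eq_finite_toFinset_sum _ hfin, Finset.mul_sum]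
  calc _ = ∑ u, ∑ e ∈ hfin.toFinset with u ∈ e, w e := by
        refine Finset.sum_congr rfl fun u _ => ?_
        split_ifs with h
        · rw [Finset.sum_eq_single_of_mem s(u, σ u)]
          · simpa using (hM u _).2 ⟨h, rfl⟩
          · intro e he hne
            simp only [Finset.mem_filter, Set.Finite.mem_toFinset] at he
            obtain ⟨v, rfl⟩ := he.2
            rw [SimpleGraph.Subgraph.mem_edgeSet, hM] at he
            exact absurd (by rw [he.1.2]) hne
        · refine (Finset.sum_eq_zero fun e he => ?_).symm
          simp only [Finset.mem_filter, Set.Finite.mem_toFinset] at he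
          obtain ⟨v, rfl⟩ := he.2
          rw [SimpleGraph.Subgraph.mem_edgeSet, hM] at he
          exact absurd he.1.1 h
    _ = ∑ e ∈ hfin.toFinset, ∑ u ∈ e.toFinset, w e := by
        refine Finset.sum_comm' fun u e => ?_
        simp
        tauto
    _ = _ := by
        refine Finset.sum_congr rfl fun e he => ?_
        rw [Finset.sum_const, smul_eq_mul, Sym2.card_toFinset_of_not_isDiag]
        exact G.not_isDiag_of_mem_edgeSet (M.edgeSet_subset ((Set.Finite.mem_toFinset _).1 he))

/-- The index of a neighbour of `u^i` is forced to be `w e + 1 - i`, so a neighbourhood contains at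
most one copy of each vertex. -/
theorem injOn_fst_neighborSet_of_le_unfolding {V : Type*} [Finite V] {G : SimpleGraph V}
    {w : Sym2 V → ℕ} {H : (⊤ : SimpleGraph (V × ℕ)).Subgraph} (hH : H ≤ unfolding G w)
    (p : V × ℕ) : Set.InjOn Prod.fst (H.neighborSet p) := by
  rintro ⟨a, i⟩ ha ⟨b, j⟩ hb (rfl : a = b)
  obtain ⟨_, _, _, h1⟩ := hH.2 ha
  obtain ⟨_, _, _, h2⟩ := hH.2 hb
  have : i = j := by
    dsimp only at h1 h2
    omega
  rw [this]

theorem exists_neighborFinset {V : Type*} [Finite V] {G : SimpleGraph V}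
    {w : Sym2 V → ℕ} {H : (⊤ : SimpleGraph (V × ℕ)).Subgraph} (hH : H ≤ unfolding G w) :
    ∃ N : V × ℕ → Finset (V × ℕ), (∀ p q, q ∈ N p ↔ H.Adj p q) ∧ ∀ p, (N p).card = deg H p := by
  have hfin : ∀ p, (H.neighborSet p).Finite := fun p =>
    Set.Finite.of_finite_image (Set.toFinite _) (injOn_fst_neighborSet_of_le_unfolding hH p)
  exact ⟨fun p => (hfin p).toFinset, fun p q => by simp,
    fun p => (Set.ncard_eq_toFinset_card _ (hfin p)).symm⟩

/-- The set `S` of copies of matched vertices that avoid `C` together with their partners is large, and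
a lower bound for `d` summed over partner pairs in `S` gives one for the total of `d` over `S`. -/
theorem two_mul_sum_degree_ge {V : Type*} [Fintype V] [DecidableEq V] {σ : V → V}
    (hσ : σ.Involutive) {W : V → ℕ} (hW : ∀ u, W (σ u) = W u) (C : Finset (V × ℕ)) :
    ∃ S ⊆ copies W, S ∩ C = ∅ ∧ (copies W).card ≤ S.card + 2 * C.card ∧
      ∀ (d : V × ℕ → ℝ) (b : ℝ),
        (∀ u i j, (u, i) ∈ S → (σ u, j) ∉ C → 1 ≤ j → i + j = W u + 1 → b ≤ d (u, i) + d (σ u, j)) →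
        b * S.card ≤ 2 * ∑ p ∈ S, d p := by
  -- `τ` sends a copy to its partner in the unfolded matching. Deleting `C` and its `τ`-preimage
  -- leaves `S`, whence the loss of `2 * C.card`; `S` is `τ`-stable, so summing over pairs counts
  -- `d` twice.
  let τ : V × ℕ → V × ℕ := fun p => (σ p.1, W p.1 + 1 - p.2)
  have hτ : ∀ p ∈ copies W, τ p ∈ copies W := by
    intro p hp
    rw [mem_copies] at hp ⊢
    simp only [τ, hW]
    omega
  have hττ : ∀ p ∈ copies W, τ (τ p) = p := by
    rintro ⟨u, i⟩ hp
    rw [mem_copies] at hp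
    simp only [τ, hW, hσ u, Prod.mk.injEq, true_and]
    dsimp only at hp
    omega
  have hS : ∀ p, p ∈ (copies W).filter (fun p => p ∉ C ∧ τ p ∉ C) ↔
      p ∈ copies W ∧ p ∉ C ∧ τ p ∉ C := fun p => Finset.mem_filter
  refine ⟨(copies W).filter fun p => p ∉ C ∧ τ p ∉ C, Finset.filter_subset _ _, ?_, ?_, ?_⟩
  · ext p
    simp only [Finset.mem_inter, hS, Finset.notMem_empty, iff_false]
    tauto
  · have h1 : ((copies W).filter fun p => τ p ∈ C).card ≤ C.card := by
      refine Finset.card_le_card_of_injOn τ (fun p hp => (Finset.mem_filter.1 hp).2) ?_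
      intro p hp q hq h
      rw [← hττ p (Finset.mem_filter.1 hp).1, ← hττ q (Finset.mem_filter.1 hq).1, h]
    have h2 : copies W ⊆ ((copies W).filter fun p => p ∉ C ∧ τ p ∉ C) ∪
        (C ∪ (copies W).filter fun p => τ p ∈ C) := by
      intro p hp
      simp only [Finset.mem_union, hS, Finset.mem_filter]
      tauto
    have h3 := Finset.card_le_card h2
    have h4 := Finset.card_union_le ((copies W).filter fun p => p ∉ C ∧ τ p ∉ C)
      (C ∪ (copies W).filter fun p => τ p ∈ C)
    have h5 := Finset.card_union_le C ((copies W).filter fun p => τ p ∈ C)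
    omega
  · intro d b hd
    set S := (copies W).filter fun p => p ∉ C ∧ τ p ∉ C with hSdef
    have hSτ : ∀ p ∈ S, τ p ∈ S := by
      intro p hp
      rw [hS] at hp ⊢
      exact ⟨hτ p hp.1, hp.2.2, by rw [hττ p hp.1]; exact hp.2.1⟩
    have hsum : ∑ p ∈ S, d p = ∑ p ∈ S, d (τ p) :=
      Finset.sum_nbij' τ τ hSτ hSτ (fun p hp => hττ p ((hS p).1 hp).1)
        (fun p hp => hττ p ((hS p).1 hp).1) fun p hp => by rw [hττ p ((hS p).1 hp).1]
    calc b * S.card = ∑ p ∈ S, b := by rw [Finset.sum_const, nsmul_eq_mul, mul_comm]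
      _ ≤ ∑ p ∈ S, (d p + d (τ p)) := by
          refine Finset.sum_le_sum fun p hp => ?_
          obtain ⟨h1, h2, h3⟩ := (hS p).1 hp
          rw [mem_copies] at h1
          exact hd p.1 p.2 (W p.1 + 1 - p.2) hp h3 (by omega) (by omega)
      _ = 2 * ∑ p ∈ S, d p := by rw [Finset.sum_add_distrib, ← hsum, two_mul]

/-! ### Assembling the bound -/

theorem maxMatchingWeight_refolding_ge {V : Type*} [Finite V] {G : SimpleGraph V}
    {w : Sym2 V → ℕ} {lam β : ℝ} (hlam0 : 0 < lam) (hlam : lam ≤ 1 / 2)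
    (hβ : 1 ≤ lam ^ 2 * β) {GS : SimpleGraph V} (hGS : GS ≤ G)
    {H : (⊤ : SimpleGraph (V × ℕ)).Subgraph} (hH : H ≤ unfolding G w)
    (hHβ : BoundedEdgeDegree H β) :
    (2 / 3 - 28 * lam) * (maxMatchingWeight GS w : ℝ) ≤
      (maxMatchingWeight (refolding G w
        (H.edgeSet ∪ underfullEdges (unfolding GS w) H β lam)) w : ℝ) := by
  classical
  have := Fintype.ofFinite V
  have hβ0 : 0 < β := by
    by_contra! h
    nlinarith [sq_nonneg lam]
  set F := H.edgeSet ∪ underfullEdges (unfolding GS w) H β lam with hF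
  obtain ⟨M, hM, hMw⟩ := (maxMatchingWeight_isGreatest GS w).1
  obtain ⟨σ, hσ, hMσ⟩ := exists_matching_involution hM
  have hsumW := sum_matching_weight hMσ w
  rw [← hMw] at hsumW
  set Wt : V → ℕ := fun u => if σ u ≠ u then w s(u, σ u) else 0 with hWt
  have hWσ : ∀ u, Wt (σ u) = Wt u := by
    intro u
    by_cases h : σ u = u
    · rw [h]
    · have h' : u ≠ σ u := fun h' => h h'.symm
      simp only [hWt, hσ u, ne_eq, h, h', not_false_eq_true, if_true, Sym2.eq_swap]
  obtain ⟨N, hN, hNdeg⟩ := exists_neighborFinset hH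
  have hdeg : ∀ p, ∀ q ∈ N p, ((N p).card : ℝ) + (N q).card ≤ β := by
    intro p q hq
    rw [hNdeg, hNdeg]
    exact hHβ p q ((hN p q).1 hq)
  have hNβ : ∀ p, ((N p).card : ℝ) ≤ β := by
    intro p
    rcases (N p).eq_empty_or_nonempty with h | ⟨q, hq⟩
    · simpa [h] using hβ0.le
    · have := hdeg p q hq
      have : (0 : ℝ) ≤ (N q).card := Nat.cast_nonneg _
      linarith
  have hNinj : ∀ p, Set.InjOn Prod.fst (N p : Set (V × ℕ)) := fun p =>
    (injOn_fst_neighborSet_of_le_unfolding hH p).mono fun q hq => (hN p q).1 hq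
  obtain ⟨s, hs, hdisc⟩ :=
    exists_coloring_of_small_discrepancy hσ hlam0 hβ N hNinj hNβ (copies Wt)
  obtain ⟨c, hcsum, hc⟩ := exists_weight_cover (refolding G w F) w s
  -- If `i > c u` and `j > c v`, then `w e + 1 = i + j ≥ c u + c v + 2`, contradicting `w e ≤ c u +
  -- c v`.
  have hcover : ∀ p q : V × ℕ, s(p, q) ∈ F → G.Adj p.1 q.1 → 1 ≤ p.2 → 1 ≤ q.2 →
      p.2 + q.2 = w s(p.1, q.1) + 1 → s p.1 ≠ s q.1 → p ∉ copies c → q ∈ copies c := by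
    intro p q hpq hadj hp hq hsum hne hpc
    have := hc p.1 q.1 ⟨hadj, p.2, q.2, hp, hq, hsum, hpq⟩ hne
    rw [mem_copies] at hpc ⊢
    omega
  obtain ⟨S, hSsub, hSC, hScard, hSdeg⟩ := two_mul_sum_degree_ge hσ hWσ (copies c)
  have hSnot : ∀ p ∈ S, p ∉ copies c := fun p hp hpc =>
    Finset.notMem_empty p (hSC ▸ Finset.mem_inter.2 ⟨hp, hpc⟩)
  have hkey := card_cover_lower_bound N (fun p => (N p).filter fun q => s p.1 ≠ s q.1)
    (fun p => Finset.filter_subset _ _)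
    (fun p q h => by
      simp only [Finset.mem_filter, hN] at h ⊢
      exact ⟨h.1.symm, h.2.symm⟩)
    β lam hβ0.le (fun p => discrepancy s (N p)) (fun p => abs_card_bichromatic_sub_le s p _)
    hdeg S (copies c)
    (fun p hp q hq => by
      simp only [Finset.mem_filter, hN] at hq
      obtain ⟨h1, h2, h3, h4⟩ := hH.2 hq.1
      exact hcover p q (Or.inl hq.1) h1 h2 h3 h4 hq.2 (hSnot p hp))
    (hSdeg (fun p => ((N p).card : ℝ)) (β * (1 - lam)) (by
      intro u i j hi hj hj1 hij
      by_contra! hlt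
      have hi' := mem_copies.1 (hSsub hi)
      have hu : σ u ≠ u := by
        intro hu
        simp only [hWt, hu, ne_eq, not_true_eq_false, if_false] at hi'
        omega
      have hGSadj : GS.Adj u (σ u) := M.adj_sub ((hMσ _ _).2 ⟨hu, rfl⟩)
      have hWu : Wt u = w s(u, σ u) := if_pos hu
      rw [hWu] at hij
      refine hj (hcover (u, i) (σ u, j) ?_ (hGS hGSadj) hi'.1 hj1 hij (hs u hu) (hSnot _ hi))
      -- With degree sum below `β * (1 - lam)`, the matched edge is in `H` or underfull; either way
      -- it is covered by `C`, contrary to the choice of `S`.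
      by_cases hmem : s((u, i), (σ u, j)) ∈ H.edgeSet
      · exact Or.inl hmem
      · refine Or.inr ⟨⟨?_, hmem⟩, _, _, rfl, ?_⟩
        · exact ⟨hGSadj, hi'.1, hj1, hij⟩
        · rw [← hNdeg, ← hNdeg]
          exact hlt))
  have hmono : ∑ p ∈ S, ∑ q ∈ N p, (discrepancy s (N p) + discrepancy s (N q)) +
        β / 2 * ∑ p ∈ S, discrepancy s (N p) ≤
      ∑ p ∈ copies Wt, ∑ q ∈ N p, (discrepancy s (N p) + discrepancy s (N q)) +
        β / 2 * ∑ p ∈ copies Wt, discrepancy s (N p) := by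
    gcongr
    · exact fun p _ _ => Finset.sum_nonneg fun q _ =>
        add_nonneg (discrepancy_nonneg _ _) (discrepancy_nonneg _ _)
    · exact fun p _ _ => discrepancy_nonneg _ _
  have h1 := hkey.trans (hmono.trans hdisc)
  rw [card_copies Wt, hsumW] at h1 hScard
  push_cast at h1
  -- `80 = 16 * (5 / 2) * 2`, the last factor because `copies Wt` has `2μ` elements. With `h3` this
  -- gives `(2 - 84 * lam) * μ ≤ 3 * |C|`, hence the `28 * lam`.
  have h2 : (1 - 2 * lam) * S.card - (copies c).card ≤ 80 * lam * maxMatchingWeight GS w := by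
    refine le_of_mul_le_mul_left (h1.trans (le_of_eq ?_)) (by positivity : 0 < β ^ 2 / 16)
    ring
  have h3 : (2 * maxMatchingWeight GS w : ℝ) ≤ S.card + 2 * (copies c).card := by
    exact_mod_cast hScard
  have h4 : ((copies c).card : ℝ) ≤ maxMatchingWeight (refolding G w F) w := by
    rw [card_copies]
    exact_mod_cast hcsum
  have h5 := mul_le_mul_of_nonneg_left h3 (by linarith : 0 ≤ 1 - 2 * lam)
  have h6 : 0 ≤ lam * (copies c).card := by positivity
  linarith

end Refolding

theorem mainTheorem6 {V : Type*} [Finite V] (G : SimpleGraph V) (w : Sym2 V → ℕ) (W : ℕ)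
    (hw : ∀ e ∈ G.edgeSet, 1 ≤ w e ∧ w e ≤ W)
    (ε lam β : ℝ) (hε : 0 < ε) (hlam_pos : 0 < lam) (hlam : lam ≤ ε / 512)
    (hβ : 144 / lam ^ 2 * Real.log (2 * (W : ℝ) / lam) ≤ β)
    (GS : SimpleGraph V) (hGS : GS ≤ G)
    (H : (⊤ : SimpleGraph (V × ℕ)).Subgraph) (hH : H ≤ Refolding.unfolding G w)
    (hHβ : Refolding.BoundedEdgeDegree H β) :
    (2 / 3 - ε) * (Refolding.maxMatchingWeight GS w : ℝ) ≤
      (Refolding.maxMatchingWeight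
        (Refolding.refolding G w
          (H.edgeSet ∪ Refolding.underfullEdges (Refolding.unfolding GS w) H β lam)) w : ℝ) := by
  have hμ : (0 : ℝ) ≤ Refolding.maxMatchingWeight GS w := Nat.cast_nonneg _
  rcases le_or_gt (2 / 3) ε with hε' | hε'
  · exact (mul_nonpos_of_nonpos_of_nonneg (by linarith) hμ).trans (Nat.cast_nonneg _)
  rcases Nat.eq_zero_or_pos W with rfl | hW
  · obtain ⟨M, -, hM⟩ := (Refolding.maxMatchingWeight_isGreatest GS w).1
    have hzero : Refolding.maxMatchingWeight GS w = 0 := by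
      rw [hM]
      refine finsum_mem_eq_zero_of_forall_eq_zero fun e he => ?_
      exact Nat.le_zero.1 (hw e (SimpleGraph.edgeSet_mono hGS (M.edgeSet_subset he))).2
    rw [hzero, Nat.cast_zero, mul_zero]
    exact Nat.cast_nonneg _
  have hW1 : (1 : ℝ) ≤ W := by exact_mod_cast hW
  -- The argument exceeds `e`, as `W ≥ 1` and `lam < 1 / 512`. Only `1 ≤ lam ^ 2 * β` is needed from
  -- the bound on `β`.
  have hlog : 1 ≤ Real.log (2 * (W : ℝ) / lam) := by
    rw [Real.le_log_iff_exp_le (by positivity), le_div_iff₀ hlam_pos]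
    nlinarith [Real.exp_one_lt_d9]
  have hβ' : 1 ≤ lam ^ 2 * β := by
    have h := mul_le_mul_of_nonneg_left hβ (sq_nonneg lam)
    have h' : lam ^ 2 * (144 / lam ^ 2 * Real.log (2 * (W : ℝ) / lam)) =
        144 * Real.log (2 * (W : ℝ) / lam) := by
      field_simp
    linarith
  refine le_trans ?_
    (Refolding.maxMatchingWeight_refolding_ge hlam_pos (by linarith) hβ' hGS hH hHβ)
  exact mul_le_mul_of_nonneg_right (by linarith) hμ
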